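/- Let $E$ be a finite set. A *submodular system* on $E$ is a triple $S=(E,\mathcal D,\rho)$, where $\mathcal D\subseteq 2^E$ contains $\emptyset$ and $E$, is closed under union and intersection, and is accessible (for every nonempty $A\in\mathcal D$ there is $x\in A$ with $A\setminus\{x\}\in\mathcal D$), and where $\rho:\mathcal D\to\mathbb R$ satisfies $\rho(\emptyset)=0$, $\rho(A)\le\rho(B)$ whenever $A\subseteq B$, and $\rho(A\cup B)+\rho(A\cap B)\le\rho(A)+\rho(B)$ for all $A,B\in\mathcal D$. Writing $\mathbf x(A)=\sum_{a\in A}x_a$, its *base polyhedron* is $$\mathfrak B(S)=\{\mathbf x\in\mathbb R^E : \mathbf x(A)\le\rho(A)\ \text{for all } A\in\mathcal D,\ \mathbf x(E)=\rho(E)\}.$$ A *U-matroid* is a submodular system such that $\rho(A)\in\mathbb N$ for all $A\in\mathcal D$, and $\rho(B)-\rho(A)\le 1$ whenever $A,B\in\mathcal D$ and $B=A\cup\{e\}$ for some $e\in E$. An *extended 0/1 generalized permutahedron* in $\mathbb R^E$ is a (possibly unbounded) polyhedron $\mathfrak p\subseteq\mathbb R^E$ such that every one-dimensional face of $\mathfrak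 p$, bounded or unbounded, is parallel to $\mathbf e_i-\mathbf e_j$ for some $i\ne j$ in $E$; every vertex of $\mathfrak p$ is a $0,1$-vector; and $\mathfrak p$ has at least one vertex. **Theorem 3.3.** The map $S\mapsto\mathfrak B(S)$ is injective on submodular systems on $E$, so that it is a bijective correspondence between submodular systems and their base polyhedra. This correspondence restricts to a bijection from the set of U-matroids on $E$ onto the set of extended 0/1 generalized permutahedra in $\mathbb R^E$. Moreover, a submodular system $S$ is a U-matroid if and only if $\mathfrak B(S)$ is an extended 0/1 generalized permutahedron. -/

import Mathlib

/-- A submodular system on a finite ground set `E`: an accessible lattice of subsets of `E`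
(containing `∅` and `E`, closed under union and intersection), together with a calibrated,
monotone, submodular real-valued rank function on it. In `Finset E`, the operations `⊔` and `⊓`
are union and intersection. -/
structure SubmodularSystem (E : Type*) [Fintype E] [DecidableEq E] where
  /-- the family of subsets on which the rank function is defined -/
  lattice : Sublattice (Finset E)
  empty_mem : ∅ ∈ lattice
  univ_mem : Finset.univ ∈ lattice
  accessible : ∀ A ∈ lattice, A.Nonempty → ∃ x ∈ A, A.erase x ∈ lattice
  /-- the rank function -/
  rank : lattice → ℝ
  calibrated : rank ⟨∅, empty_mem⟩ = 0
  monotone : ∀ A B : lattice, A ≤ B → rank A ≤ rank B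
  submodular : ∀ A B : lattice, rank (A ⊔ B) + rank (A ⊓ B) ≤ rank A + rank B

namespace SubmodularSystem

variable {E : Type*} [Fintype E] [DecidableEq E]

/-- The submodular polyhedron: all `x` with `x(A) ≤ ρ(A)` for every `A` in the lattice. -/
def submodularPolyhedron (S : SubmodularSystem E) : Set (E → ℝ) :=
  {x | ∀ A : S.lattice, ∑ e ∈ (A : Finset E), x e ≤ S.rank A}

/-- The base polyhedron: the points `x` of the submodular polyhedron with `x(E) = ρ(E)`. -/
def basePolyhedron (S : SubmodularSystem E) : Set (E → ℝ) :=
  {x | x ∈ S.submodularPolyhedron ∧ ∑ e, x e = S.rank ⟨Finset.univ, S.univ_mem⟩}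

/-- A U-matroid is a submodular system whose rank function takes values in the natural numbers
and increases by at most one when a single element is adjoined. -/
def IsUMatroid (S : SubmodularSystem E) : Prop :=
  (∀ A : S.lattice, ∃ k : ℕ, S.rank A = k) ∧
  ∀ (A B : S.lattice) (e : E), (B : Finset E) = insert e (A : Finset E) →
    S.rank B - S.rank A ≤ 1

end SubmodularSystem

/-- A (possibly unbounded, possibly empty) polyhedron in `ℝ^E`: the solution set of finitely many
weak linear inequalities. -/
def IsPolyhedron {E : Type*} [Fintype E] (p : Set (E → ℝ)) : Prop :=
  ∃ (m : ℕ) (M : Matrix (Fin m) E ℝ) (b : Fin m → ℝ), p = {x | ∀ k, (M.mulVec x) k ≤ b k}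

/-- An extended generalized permutahedron: a polyhedron all of whose one-dimensional faces
(bounded or unbounded) are parallel to a difference of two standard basis vectors. The nonempty
faces of a polyhedron are its nonempty exposed subsets, that is, the sets of points at which some
linear functional attains its optimum; `p` itself is included (take the zero functional). -/
def IsExtendedGeneralizedPermutahedron {E : Type*} [Fintype E] [DecidableEq E]
    (p : Set (E → ℝ)) : Prop :=
  IsPolyhedron p ∧
  ∀ F : Set (E → ℝ), IsExposed ℝ p F → Module.finrank ℝ (vectorSpan ℝ F) = 1 →
    ∃ i j : E, i ≠ j ∧
      vectorSpan ℝ F = Submodule.span ℝ {(Pi.single i 1 - Pi.single j 1 : E → ℝ)}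

/-- An extended 0/1 generalized permutahedron (unbounded matroid polyhedron): an extended
generalized permutahedron with at least one vertex, all of whose vertices have coordinates
in `{0, 1}`. The vertices (zero-dimensional faces) of a polyhedron are its exposed points. -/
def IsUPolyhedron {E : Type*} [Fintype E] [DecidableEq E] (p : Set (E → ℝ)) : Prop :=
  IsExtendedGeneralizedPermutahedron p ∧
  (∀ v ∈ Set.exposedPoints ℝ p, ∀ e : E, v e = 0 ∨ v e = 1) ∧
  (Set.exposedPoints ℝ p).Nonempty

/-! A submodular system can be read off its base polyhedron: the lattice consists of the sets `A`
for which x(A) is bounded above, and the rank of `A` is the maximum of x(A). The greedy algorithm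
along a chain through `A` gives a vertex attaining it (`exists_exposedPoint_sum_eq`), while a set
outside the lattice is unbounded along some ray e_j - e_i (`mem_lattice_of_sum_le`).

The sets tight at a point are closed under union and intersection. Where they separate elements,
every coordinate is a difference of two ranks; this happens at vertices, so U-matroids have 0/1
vertices. At the midpoint of two points of an edge they fail to separate some i and j, and the edge
runs along e_i - e_j. Conversely, ranks and their increments are read off greedy vertices.

Surjectivity rests on `IsUPolyhedron.exists_common_max`: an edge direction only compares two
coordinates, so a vertex maximising w also maximises every functional ordered like w, in particular
the indicators of upper level sets of w. Taking w = 1_A + 1_B gives submodularity; taking w to be a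
row of the defining system, Abel summation deduces that row from the set inequalities. -/

theorem exists_step_length {ι : Type*} [Fintype ι] (a c : ι → ℝ) (ha : ∀ i, 0 ≤ a i)
    (hc : ∃ i, 0 < c i) :
    ∃ s : ℝ, 0 ≤ s ∧ (∀ i, s * c i ≤ a i) ∧ ∃ i, 0 < c i ∧ s * c i = a i := by
  classical
  obtain ⟨i₀, hi₀⟩ := hc
  -- Ratio test: the constraint hit first is the one with the smallest `a i / c i` among those with
  -- `0 < c i`.
  obtain ⟨i, hi, hmin⟩ := Finset.exists_min_image (Finset.univ.filter fun i => 0 < c i)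
    (fun i => a i / c i) ⟨i₀, by simpa using hi₀⟩
  have hci : 0 < c i := by simpa using hi
  refine ⟨a i / c i, div_nonneg (ha i) hci.le, fun j => ?_, i, hci, by field_simp⟩
  rcases lt_or_ge 0 (c j) with hj | hj
  · exact (le_div_iff₀ hj).1 (hmin j (by simpa using hj))
  · exact (mul_nonpos_of_nonneg_of_nonpos (div_nonneg (ha i) hci.le) hj).trans (ha j)

theorem exists_pos_step {ι : Type*} [Fintype ι] (a c : ι → ℝ) (ha : ∀ i, 0 ≤ a i)
    (hc : ∀ i, a i = 0 → c i ≤ 0) : ∃ s : ℝ, 0 < s ∧ ∀ i, s * c i ≤ a i := by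
  by_cases h : ∃ i, 0 < c i
  · obtain ⟨s, hs, hsa, i, hi, hsi⟩ := exists_step_length a c ha h
    refine ⟨s, lt_of_le_of_ne hs ?_, hsa⟩
    rintro rfl
    have := hc i (by linarith)
    linarith
  · push Not at h
    exact ⟨1, one_pos, fun i => by linarith [h i, ha i]⟩

/-! ### Vertices and edges of polyhedra given by inequalities -/

section Polyhedra

variable {E ι : Type*} [Fintype E]

/-- The solution set of the system of inequalities `M x ≤ b`. -/
def solutionSet (M : ι → E → ℝ) (b : ι → ℝ) : Set (E → ℝ) := {x | ∀ i, M i ⬝ᵥ x ≤ b i}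

/-- A solution of `M x ≤ b` determined by the inequalities which are tight at it. -/
def IsBasicSolution (M : ι → E → ℝ) (b : ι → ℝ) (x : E → ℝ) : Prop :=
  x ∈ solutionSet M b ∧ ∀ v : E → ℝ, (∀ i, M i ⬝ᵥ x = b i → M i ⬝ᵥ v = 0) → v = 0

/-- The linear functional `x ↦ w ⬝ᵥ x`, as a continuous linear map. -/
noncomputable def dotCLM (w : E → ℝ) : (E → ℝ) →L[ℝ] ℝ :=
  LinearMap.toContinuousLinearMap
    { toFun := fun x => w ⬝ᵥ x
      map_add' := fun x y => dotProduct_add w x y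
      map_smul' := fun c x => by simp [dotProduct_smul] }

@[simp]
theorem dotCLM_apply (w x : E → ℝ) : dotCLM w x = w ⬝ᵥ x := rfl

/-- The sum of the rows in `I` exposes this face: it is at most the sum of the `b i`, with equality
exactly when each row in `I` is tight. -/
theorem isExposed_tight (M : ι → E → ℝ) (b : ι → ℝ) (I : Finset ι) :
    IsExposed ℝ (solutionSet M b) {y ∈ solutionSet M b | ∀ i ∈ I, M i ⬝ᵥ y = b i} := by
  rintro ⟨x, hx, hxI⟩
  refine ⟨dotCLM (∑ i ∈ I, M i), Set.ext fun y => ⟨fun hy => ⟨hy.1, fun z hz => ?_⟩,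
    fun hy => ⟨hy.1, ?_⟩⟩⟩
  · simp only [dotCLM_apply, sum_dotProduct]
    exact Finset.sum_le_sum fun i hi => (hz i).trans (hy.2 i hi).ge
  · have h := hy.2 x hx
    simp only [dotCLM_apply, sum_dotProduct] at h
    have h' : ∑ i ∈ I, M i ⬝ᵥ y = ∑ i ∈ I, b i :=
      le_antisymm (Finset.sum_le_sum fun i _ => hy.1 i)
        ((Finset.sum_congr rfl fun i hi => (hxI i hi).symm).le.trans h)
    exact (Finset.sum_eq_sum_iff_of_le fun i _ => hy.1 i).1 h'

theorem IsBasicSolution.mem_exposedPoints [Fintype ι] {M : ι → E → ℝ} {b : ι → ℝ} {x : E → ℝ}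
    (hx : IsBasicSolution M b x) : x ∈ Set.exposedPoints ℝ (solutionSet M b) := by
  classical
  rw [mem_exposedPoints_iff_exposed_singleton]
  have h := isExposed_tight M b (Finset.univ.filter fun i => M i ⬝ᵥ x = b i)
  suffices h' : {y ∈ solutionSet M b | ∀ i ∈ Finset.univ.filter fun i => M i ⬝ᵥ x = b i,
      M i ⬝ᵥ y = b i} = {x} by rwa [h'] at h
  refine Set.eq_singleton_iff_unique_mem.2 ⟨⟨hx.1, fun i hi => (Finset.mem_filter.1 hi).2⟩, ?_⟩
  rintro y ⟨-, h⟩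
  refine sub_eq_zero.1 (hx.2 _ fun i hi => ?_)
  rw [dotProduct_sub, h i (by simpa using hi), hi, sub_self]

/-- Both `x + v` and `x - v` are feasible, and a functional with `x` as its only maximiser cannot
decrease strictly in both directions. -/
theorem eq_zero_of_mem_exposedPoints {M : ι → E → ℝ} {b : ι → ℝ} {x : E → ℝ}
    (hx : x ∈ Set.exposedPoints ℝ (solutionSet M b)) (v : E → ℝ) (hv : ∀ i, M i ⬝ᵥ v = 0) :
    v = 0 := by
  obtain ⟨hx, l, hl⟩ := hx
  have h1 := hl (x + v) fun i => by rw [dotProduct_add, hv, add_zero]; exact hx i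
  have h2 := hl (x - v) fun i => by rw [dotProduct_sub, hv, sub_zero]; exact hx i
  simp only [map_add, map_sub] at h1 h2
  simpa using h1.2 (by linarith)

/-- In a polyhedron without lines, every point is dominated by a basic solution with respect to
a functional which is bounded above. -/
theorem exists_isBasicSolution_ge [Fintype ι] {M : ι → E → ℝ} {b : ι → ℝ}
    (hM : ∀ v : E → ℝ, (∀ i, M i ⬝ᵥ v = 0) → v = 0) {w : E → ℝ} {K : ℝ}
    (hK : ∀ y ∈ solutionSet M b, w ⬝ᵥ y ≤ K) {y : E → ℝ} (hy : y ∈ solutionSet M b) :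
    ∃ x, IsBasicSolution M b x ∧ w ⬝ᵥ y ≤ w ⬝ᵥ x := by
  classical
  let T : (E → ℝ) → Finset ι := fun x => Finset.univ.filter fun i => M i ⬝ᵥ x = b i
  let P : Set (E → ℝ) := {x | x ∈ solutionSet M b ∧ w ⬝ᵥ y ≤ w ⬝ᵥ x}
  -- Among the feasible points at least as good as `y`, take one with a maximal set of tight
  -- constraints; walking from it until a new constraint becomes tight contradicts maximality.
  obtain ⟨_, hmax⟩ := (Set.toFinite (T '' P)).exists_maximal ⟨_, y, ⟨hy, le_rfl⟩, rfl⟩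
  obtain ⟨⟨x, ⟨hx, hwx⟩, rfl⟩, hmax⟩ := hmax
  refine ⟨x, ⟨hx, ?_⟩, hwx⟩
  have key : ∀ v : E → ℝ, (∀ i, M i ⬝ᵥ x = b i → M i ⬝ᵥ v = 0) → 0 ≤ w ⬝ᵥ v →
      ∀ i, M i ⬝ᵥ v ≤ 0 := by
    intro v hv hwv
    by_contra! hpos
    obtain ⟨s, hs, hsa, i, hi, hsi⟩ := exists_step_length (fun i => b i - M i ⬝ᵥ x)
      (fun i => M i ⬝ᵥ v) (fun i => sub_nonneg.2 (hx i)) hpos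
    have hxs : x + s • v ∈ P := by
      refine ⟨fun j => ?_, ?_⟩
      · have := hsa j
        rw [dotProduct_add, dotProduct_smul, smul_eq_mul]
        linarith
      · rw [dotProduct_add, dotProduct_smul, smul_eq_mul]
        have := mul_nonneg hs hwv
        linarith
    have hsub : T x ≤ T (x + s • v) := by
      intro j hj
      simp only [T, Finset.mem_filter, Finset.mem_univ, true_and] at hj ⊢
      rw [dotProduct_add, dotProduct_smul, hv j hj, hj, smul_zero, add_zero]
    have hmem := hmax ⟨_, hxs, rfl⟩ hsub
      (show i ∈ T (x + s • v) by
        simp only [T, Finset.mem_filter, Finset.mem_univ, true_and]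
        rw [dotProduct_add, dotProduct_smul, smul_eq_mul, hsi]; ring)
    simp only [T, Finset.mem_filter, Finset.mem_univ, true_and] at hmem
    exact hi.ne' (hv i hmem)
  have key' : ∀ v : E → ℝ, (∀ i, M i ⬝ᵥ x = b i → M i ⬝ᵥ v = 0) → 0 ≤ w ⬝ᵥ v → v = 0 := by
    intro v hv hwv
    have h1 := key v hv hwv
    have hw0 : w ⬝ᵥ v = 0 := by
      by_contra hne
      have hpos : 0 < w ⬝ᵥ v := lt_of_le_of_ne hwv (Ne.symm hne)
      -- This multiple of `v` would bring the value of `w` to `K + 1`.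
      have hray : x + ((K - w ⬝ᵥ x + 1) / (w ⬝ᵥ v)) • v ∈ solutionSet M b := by
        intro j
        rw [dotProduct_add, dotProduct_smul, smul_eq_mul]
        have h2 : 0 ≤ (K - w ⬝ᵥ x + 1) / (w ⬝ᵥ v) :=
          div_nonneg (by linarith [hK x hx]) hwv
        linarith [mul_nonpos_of_nonneg_of_nonpos h2 (h1 j), hx j]
      have h3 := hK _ hray
      rw [dotProduct_add, dotProduct_smul, smul_eq_mul, div_mul_cancel₀ _ hne] at h3
      linarith
    refine hM v fun i => le_antisymm (h1 i) ?_
    have h4 := key (-v) (fun i hi => by rw [dotProduct_neg, hv i hi, neg_zero])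
      (by rw [dotProduct_neg, hw0, neg_zero]) i
    rw [dotProduct_neg] at h4
    linarith
  intro v hv
  rcases le_total 0 (w ⬝ᵥ v) with h | h
  · exact key' v hv h
  · exact neg_eq_zero.1 (key' (-v) (fun i hi => by rw [dotProduct_neg, hv i hi, neg_zero])
      (by rw [dotProduct_neg]; linarith))

/-- If a functional is not maximal at a basic solution `x`, then it increases along some edge
issuing from `x`. -/
theorem IsBasicSolution.exists_edge [Fintype ι] {M : ι → E → ℝ} {b : ι → ℝ} {x y : E → ℝ}
    (hx : IsBasicSolution M b x) (hy : y ∈ solutionSet M b) {u : E → ℝ}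
    (huy : u ⬝ᵥ x < u ⬝ᵥ y) :
    ∃ (d : E → ℝ) (F : Set (E → ℝ)), 0 < u ⬝ᵥ d ∧ x + d ∈ solutionSet M b ∧
      IsExposed ℝ (solutionSet M b) F ∧ vectorSpan ℝ F = Submodule.span ℝ {d} := by
  classical
  let Z : (E → ℝ) → Finset ι :=
    fun d => Finset.univ.filter fun i => M i ⬝ᵥ x = b i ∧ M i ⬝ᵥ d = 0
  let P : Set (E → ℝ) := {d | (∀ i, M i ⬝ᵥ x = b i → M i ⬝ᵥ d ≤ 0) ∧ 0 < u ⬝ᵥ d}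
  -- Among the improving feasible directions at `x`, take one that keeps a maximal set of tight
  -- constraints tight; it spans an edge.
  obtain ⟨_, hmax⟩ := (Set.toFinite (Z '' P)).exists_maximal ⟨_, y - x, ⟨fun i hi => by
    rw [dotProduct_sub, hi]; linarith [hy i], by rw [dotProduct_sub]; linarith⟩, rfl⟩
  obtain ⟨⟨d, ⟨hd, hud⟩, rfl⟩, hmax⟩ := hmax
  have key : ∀ v : E → ℝ, (∀ i, M i ⬝ᵥ x = b i → M i ⬝ᵥ d = 0 → M i ⬝ᵥ v = 0) → u ⬝ᵥ v = 0 →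
      ∀ i, M i ⬝ᵥ x = b i → M i ⬝ᵥ v ≤ 0 := by
    intro v hv huv
    by_contra! hpos
    obtain ⟨i₀, hi₀, hpos⟩ := hpos
    obtain ⟨s, hs, hsa, ⟨i, hix⟩, hi, hsi⟩ := exists_step_length
      (ι := {i // M i ⬝ᵥ x = b i}) (fun i => -(M i ⬝ᵥ d))
      (fun i => M i ⬝ᵥ v) (fun i => by linarith [hd i i.2]) ⟨⟨i₀, hi₀⟩, hpos⟩
    have hds : d + s • v ∈ P := by
      refine ⟨fun j hj => ?_, ?_⟩
      · have := hsa ⟨j, hj⟩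
        rw [dotProduct_add, dotProduct_smul, smul_eq_mul]
        linarith
      · rwa [dotProduct_add, dotProduct_smul, huv, smul_zero, add_zero]
    have hsub : Z d ≤ Z (d + s • v) := by
      intro j hj
      simp only [Z, Finset.mem_filter, Finset.mem_univ, true_and] at hj ⊢
      refine ⟨hj.1, ?_⟩
      rw [dotProduct_add, dotProduct_smul, hv j hj.1 hj.2, hj.2, smul_zero, add_zero]
    have hmem := hmax ⟨_, hds, rfl⟩ hsub
      (show i ∈ Z (d + s • v) by
        simp only [Z, Finset.mem_filter, Finset.mem_univ, true_and]
        refine ⟨hix, ?_⟩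
        rw [dotProduct_add, dotProduct_smul, smul_eq_mul, hsi]; ring)
    simp only [Z, Finset.mem_filter, Finset.mem_univ, true_and] at hmem
    exact hi.ne' (hv i hmem.1 hmem.2)
  have hW : ∀ v : E → ℝ, (∀ i, M i ⬝ᵥ x = b i → M i ⬝ᵥ d = 0 → M i ⬝ᵥ v = 0) →
      v ∈ Submodule.span ℝ {d} := by
    intro v hv
    -- Projecting along `d` into the kernel of `u` lets `key` apply to both `v'` and `-v'`.
    set v' := v - ((u ⬝ᵥ v) / (u ⬝ᵥ d)) • d with hv'
    have h1 : ∀ i, M i ⬝ᵥ x = b i → M i ⬝ᵥ d = 0 → M i ⬝ᵥ v' = 0 := by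
      intro i hi hid
      rw [hv', dotProduct_sub, dotProduct_smul, hid, hv i hi hid, smul_zero, sub_zero]
    have h2 : u ⬝ᵥ v' = 0 := by
      rw [hv', dotProduct_sub, dotProduct_smul, smul_eq_mul, div_mul_cancel₀ _ hud.ne', sub_self]
    have h3 : v' = 0 := by
      refine hx.2 v' fun i hi => le_antisymm (key v' h1 h2 i hi) ?_
      have := key (-v') (fun i hi hid => by rw [dotProduct_neg, h1 i hi hid, neg_zero])
        (by rw [dotProduct_neg, h2, neg_zero]) i hi
      rw [dotProduct_neg] at this
      linarith
    rw [sub_eq_zero.1 h3]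
    exact Submodule.smul_mem _ _ (Submodule.mem_span_singleton_self d)
  obtain ⟨s, hs, hsa⟩ := exists_pos_step (fun i => b i - M i ⬝ᵥ x) (fun i => M i ⬝ᵥ d)
    (fun i => sub_nonneg.2 (hx.1 i)) fun i hi => hd i (by linarith)
  have hxd : x + s • d ∈ solutionSet M b := fun i => by
    rw [dotProduct_add, dotProduct_smul, smul_eq_mul]
    linarith [hsa i]
  have hspan : Submodule.span ℝ {s • d} = Submodule.span ℝ {d} :=
    Submodule.span_singleton_smul_eq (IsUnit.mk0 s hs.ne') d
  refine ⟨s • d, _, ?_, hxd, isExposed_tight M b (Z d), ?_⟩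
  · rw [dotProduct_smul, smul_eq_mul]
    exact mul_pos hs hud
  have hxF : x ∈ {y ∈ solutionSet M b | ∀ i ∈ Z d, M i ⬝ᵥ y = b i} :=
    ⟨hx.1, fun i hi => by simp only [Z, Finset.mem_filter] at hi; exact hi.2.1⟩
  rw [hspan]
  apply le_antisymm
  · rw [vectorSpan_eq_span_vsub_set_right ℝ hxF, Submodule.span_le]
    rintro _ ⟨z, hz, rfl⟩
    refine hW _ fun i hi hid => ?_
    change M i ⬝ᵥ (z - x) = 0
    rw [dotProduct_sub, hi, hz.2 i (by simp [Z, hi, hid]), sub_self]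
  · rw [← hspan, Submodule.span_singleton_le_iff_mem]
    have : s • d = (x + s • d) -ᵥ x := by simp
    rw [this]
    refine vsub_mem_vectorSpan ℝ ⟨hxd, fun i hi => ?_⟩ hxF
    simp only [Z, Finset.mem_filter] at hi
    rw [dotProduct_add, dotProduct_smul, hi.2.1, hi.2.2, smul_zero, add_zero]

end Polyhedra

/-! ### Lattices of finite sets -/

section SetLattices

variable {E : Type*} [Fintype E] [DecidableEq E]

open Classical in
/-- The smallest member of the family `T` containing `i`. -/
noncomputable def latticeHull (T : Set (Finset E)) (i : E) : Finset E :=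
  Finset.univ.filter fun j => ∀ A ∈ T, i ∈ A → j ∈ A

theorem mem_latticeHull {T : Set (Finset E)} {i j : E} :
    j ∈ latticeHull T i ↔ ∀ A ∈ T, i ∈ A → j ∈ A := by
  simp [latticeHull]

theorem self_mem_latticeHull (T : Set (Finset E)) (i : E) : i ∈ latticeHull T i :=
  mem_latticeHull.2 fun _ _ h => h

theorem latticeHull_subset {T : Set (Finset E)} {A : Finset E} (hA : A ∈ T) {i : E} (hi : i ∈ A) :
    latticeHull T i ⊆ A := fun _ hj => mem_latticeHull.1 hj A hA hi

theorem latticeHull_mem {T : Set (Finset E)} (huniv : Finset.univ ∈ T) (hinf : InfClosed T)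
    (i : E) : latticeHull T i ∈ T := by
  classical
  have h : latticeHull T i
      = ((Finset.univ : Finset (Finset E)).filter fun A => A ∈ T ∧ i ∈ A).inf id := by
    ext j
    simp [mem_latticeHull, Finset.mem_inf]
  rw [h]
  exact Finset.inf_mem T huniv (fun x hx y hy => hinf hx hy) _ _ fun A hA =>
    (Finset.mem_filter.1 hA).2.1

/-- Such a set is the union of the hulls of its elements. -/
theorem mem_of_latticeHull_subset {T : Set (Finset E)} (hempty : ∅ ∈ T) (huniv : Finset.univ ∈ T)
    (hsup : SupClosed T) (hinf : InfClosed T) {A : Finset E}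
    (hA : ∀ i ∈ A, latticeHull T i ⊆ A) : A ∈ T := by
  have h : A = A.sup (latticeHull T) := by
    refine le_antisymm (fun i hi => ?_) (Finset.sup_le hA)
    exact Finset.mem_sup.2 ⟨i, hi, self_mem_latticeHull T i⟩
  rw [h]
  exact Finset.sup_mem T hempty (fun x hx y hy => hsup hx hy) _ _ fun i _ =>
    latticeHull_mem huniv hinf i

theorem erase_mem_of_notMem_latticeHull {T : Set (Finset E)} (hempty : ∅ ∈ T)
    (huniv : Finset.univ ∈ T) (hsup : SupClosed T) (hinf : InfClosed T) {A : Finset E} (hA : A ∈ T)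
    {a : E} (h : ∀ b ∈ A, b ≠ a → a ∉ latticeHull T b) : A.erase a ∈ T := by
  refine mem_of_latticeHull_subset hempty huniv hsup hinf fun i hi k hk => ?_
  obtain ⟨hia, hiA⟩ := Finset.mem_erase.1 hi
  refine Finset.mem_erase.2 ⟨?_, latticeHull_subset hA hiA hk⟩
  rintro rfl
  exact h i hiA hia hk

/-- The family `T` separates any two points. -/
def SeparatesElements (T : Set (Finset E)) : Prop :=
  ∀ i j : E, (∀ A ∈ T, i ∈ A ↔ j ∈ A) → i = j

/-- Take the hull of `i`: if the hull of some `b` in it contained `i`, then `T` would not separate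
`b` from `i`. -/
theorem SeparatesElements.exists_erase_mem {T : Set (Finset E)} (hT : SeparatesElements T)
    (hempty : ∅ ∈ T) (huniv : Finset.univ ∈ T) (hsup : SupClosed T) (hinf : InfClosed T) (i : E) :
    ∃ A ∈ T, i ∈ A ∧ A.erase i ∈ T := by
  refine ⟨_, latticeHull_mem huniv hinf i, self_mem_latticeHull T i,
    erase_mem_of_notMem_latticeHull hempty huniv hsup hinf (latticeHull_mem huniv hinf i)
      fun b hb hbi hib => hbi (hT b i fun A hA => ?_)⟩
  exact ⟨mem_latticeHull.1 hib A hA, mem_latticeHull.1 hb A hA⟩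

theorem SeparatesElements.accessible {T : Set (Finset E)} (hT : SeparatesElements T)
    (hempty : ∅ ∈ T) (huniv : Finset.univ ∈ T) (hsup : SupClosed T) (hinf : InfClosed T)
    {A : Finset E} (hA : A ∈ T) (hne : A.Nonempty) : ∃ x ∈ A, A.erase x ∈ T := by
  -- An element with the largest hull can be removed: if it lay in the hull of another `b`, the two
  -- hulls would coincide by cardinality.
  obtain ⟨a, ha, hmax⟩ := Finset.exists_max_image A (fun a => (latticeHull T a).card) hne
  refine ⟨a, ha, erase_mem_of_notMem_latticeHull hempty huniv hsup hinf hA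
    fun b hb hba hab => hba ?_⟩
  have hsub : latticeHull T a ⊆ latticeHull T b :=
    latticeHull_subset (latticeHull_mem huniv hinf b) hab
  have heq := Finset.eq_of_subset_of_card_le hsub (hmax b hb)
  have hba' : b ∈ latticeHull T a := heq ▸ self_mem_latticeHull T b
  exact hT b a fun B hB => ⟨mem_latticeHull.1 hab B hB, mem_latticeHull.1 hba' B hB⟩

end SetLattices

/-- The indicator vector of a finite set. -/
def indicatorVec {E : Type*} [DecidableEq E] (A : Finset E) : E → ℝ := fun e => if e ∈ A then 1 else 0

@[simp]
theorem indicatorVec_dotProduct {E : Type*} [Fintype E] [DecidableEq E] (A : Finset E)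
    (x : E → ℝ) : indicatorVec A ⬝ᵥ x = ∑ e ∈ A, x e := by
  simp [indicatorVec, dotProduct]

theorem isPolyhedron_solutionSet {E ι : Type*} [Fintype E] [Finite ι] (M : ι → E → ℝ)
    (b : ι → ℝ) : IsPolyhedron (solutionSet M b) := by
  obtain ⟨m, ⟨e⟩⟩ := Finite.exists_equiv_fin ι
  refine ⟨m, fun k => M (e.symm k), fun k => b (e.symm k), Set.ext fun x => ?_⟩
  exact ⟨fun h k => h (e.symm k), fun h i => by
    have : M (e.symm (e i)) ⬝ᵥ x ≤ b (e.symm (e i)) := h (e i)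
    rwa [e.symm_apply_apply] at this⟩

theorem sum_add_smul_single_sub_single {E : Type*} [DecidableEq E] (A : Finset E) (x : E → ℝ)
    (s : ℝ) (i j : E) :
    ∑ e ∈ A, (x + s • (Pi.single i 1 - Pi.single j 1 : E → ℝ)) e
      = ∑ e ∈ A, x e + s * ((if i ∈ A then 1 else 0) - if j ∈ A then 1 else 0) := by
  simp [Finset.sum_add_distrib, ← Finset.mul_sum, Finset.sum_sub_distrib]

theorem sum_update_of_notMem_finset {E : Type*} [DecidableEq E] {A : Finset E} {e : E} (he : e ∉ A) (x : E → ℝ)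
    (c : ℝ) :
    ∑ a ∈ A, Function.update x e c a = ∑ a ∈ A, x a :=
  Finset.sum_congr rfl fun _ ha =>
    Function.update_of_ne (ne_of_mem_of_not_mem ha he) _ _

/-! ### From a submodular system to its base polyhedron -/

namespace SubmodularSystem

variable {E : Type*} [Fintype E] [DecidableEq E] (S : SubmodularSystem E)

open Classical in
/-- The rank function of a submodular system, extended by zero to all sets. -/
noncomputable def rk (A : Finset E) : ℝ := if h : A ∈ S.lattice then S.rank ⟨A, h⟩ else 0

variable {S}

theorem rk_of_mem {A : Finset E} (h : A ∈ S.lattice) : S.rk A = S.rank ⟨A, h⟩ := dif_pos h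

theorem rk_empty : S.rk ∅ = 0 := (rk_of_mem S.empty_mem).trans S.calibrated

theorem union_mem {A B : Finset E} (hA : A ∈ S.lattice) (hB : B ∈ S.lattice) :
    A ∪ B ∈ S.lattice := S.lattice.supClosed hA hB

theorem inter_mem {A B : Finset E} (hA : A ∈ S.lattice) (hB : B ∈ S.lattice) :
    A ∩ B ∈ S.lattice := S.lattice.infClosed hA hB

theorem rk_mono {A B : Finset E} (hA : A ∈ S.lattice) (hB : B ∈ S.lattice) (h : A ⊆ B) :
    S.rk A ≤ S.rk B := by
  rw [rk_of_mem hA, rk_of_mem hB]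
  exact S.monotone _ _ h

theorem rk_submodular {A B : Finset E} (hA : A ∈ S.lattice) (hB : B ∈ S.lattice) :
    S.rk (A ∪ B) + S.rk (A ∩ B) ≤ S.rk A + S.rk B := by
  rw [rk_of_mem hA, rk_of_mem hB, rk_of_mem (union_mem hA hB), rk_of_mem (inter_mem hA hB)]
  exact S.submodular ⟨A, hA⟩ ⟨B, hB⟩

theorem mem_basePolyhedron {x : E → ℝ} : x ∈ S.basePolyhedron ↔
    (∀ A ∈ S.lattice, ∑ e ∈ A, x e ≤ S.rk A) ∧ ∑ e, x e = S.rk Finset.univ := by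
  rw [rk_of_mem S.univ_mem]
  refine and_congr ⟨fun h A hA => (rk_of_mem hA).symm ▸ h ⟨A, hA⟩, fun h A => ?_⟩ Iff.rfl
  exact (h A A.2).trans (rk_of_mem A.2).le

/-! ### The greedy algorithm -/

/-- `x` restricted to `A` is a vertex of the base polyhedron of the restriction of `S` to `A`. -/
structure IsGreedyVector (S : SubmodularSystem E) (A : Finset E) (x : E → ℝ) : Prop where
  le : ∀ B ∈ S.lattice, B ⊆ A → ∑ e ∈ B, x e ≤ S.rk B
  eq : ∑ e ∈ A, x e = S.rk A
  unique : ∀ d : E → ℝ, (∀ B ∈ S.lattice, B ⊆ A → ∑ e ∈ B, x e = S.rk B → ∑ e ∈ B, d e = 0) →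
    ∀ e ∈ A, d e = 0

/-- For `B` containing `e`, submodularity for `B` and `A` bounds the new coordinate by `S.rk B -
S.rk (B.erase e)`. For uniqueness, the new tight set `insert e A` fixes the coordinate at `e`. -/
theorem IsGreedyVector.insert_update {A : Finset E} {x : E → ℝ} (h : S.IsGreedyVector A x)
    (hA : A ∈ S.lattice) {e : E} (he : e ∉ A) (heA : insert e A ∈ S.lattice) :
    S.IsGreedyVector (insert e A) (Function.update x e (S.rk (insert e A) - S.rk A)) := by
  have heq : ∑ a ∈ insert e A, Function.update x e (S.rk (insert e A) - S.rk A) a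
      = S.rk (insert e A) := by
    rw [Finset.sum_insert he, sum_update_of_notMem_finset he, Function.update_self, h.eq]
    ring
  refine ⟨fun B hB hBA => ?_, heq, fun d hd => ?_⟩
  · by_cases heB : e ∈ B
    · have hB' : B ∩ A = B.erase e := by
        ext a
        simp only [Finset.mem_inter, Finset.mem_erase]
        refine ⟨fun ⟨h1, h2⟩ => ⟨fun h3 => he (h3 ▸ h2), h1⟩, fun ⟨h1, h2⟩ => ⟨h2, ?_⟩⟩
        exact (Finset.mem_insert.1 (hBA h2)).resolve_left h1
      have hBu : B ∪ A = insert e A := by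
        ext a
        simp only [Finset.mem_union, Finset.mem_insert]
        refine ⟨fun h1 => h1.elim (fun h2 => Finset.mem_insert.1 (hBA h2)) Or.inr, fun h1 => ?_⟩
        exact h1.imp (by rintro rfl; exact heB) id
      have h1 := h.le _ (inter_mem hB hA) Finset.inter_subset_right
      have h2 := rk_submodular hB hA
      rw [← Finset.add_sum_erase B _ heB, Function.update_self,
        sum_update_of_notMem_finset (Finset.notMem_erase e B)]
      rw [hB'] at h1 h2
      rw [hBu] at h2
      linarith
    · rw [sum_update_of_notMem_finset heB]
      exact h.le B hB ((Finset.subset_insert_iff_of_notMem heB).1 hBA)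
  · have h1 : ∀ a ∈ A, d a = 0 := h.unique d fun B hB hBA hBx =>
      hd B hB (hBA.trans (Finset.subset_insert e A))
        (by rwa [sum_update_of_notMem_finset fun h => he (hBA h)])
    have h2 := hd _ heA subset_rfl heq
    rw [Finset.sum_insert he, Finset.sum_eq_zero h1, add_zero] at h2
    intro a ha
    rcases Finset.mem_insert.1 ha with rfl | ha
    exacts [h2, h1 a ha]

theorem exists_isGreedyVector (A : Finset E) (hA : A ∈ S.lattice) :
    ∃ x, S.IsGreedyVector A x := by
  induction A using Finset.strongInduction with
  | H A ih =>
    rcases A.eq_empty_or_nonempty with rfl | hne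
    · refine ⟨0, fun B _ hB => ?_, by simp [rk_empty], by simp⟩
      rw [Finset.subset_empty.1 hB]
      simp [rk_empty]
    · obtain ⟨e, he, heA⟩ := S.accessible A hA hne
      obtain ⟨x, hx⟩ := ih _ (Finset.erase_ssubset he) heA
      have := hx.insert_update heA (Finset.notMem_erase e A) (by rwa [Finset.insert_erase he])
      rw [Finset.insert_erase he] at this
      exact ⟨_, this⟩

/-- Remove elements from the ground set one at a time until what remains lies in `A`; the last one
removed can be adjoined, by closure under union. -/
theorem exists_insert_mem {A : Finset E} (hA : A ∈ S.lattice) (hne : A ≠ Finset.univ) :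
    ∃ e ∉ A, insert e A ∈ S.lattice := by
  suffices h : ∀ C : Finset E, C ∈ S.lattice → ¬C ⊆ A → ∃ e ∉ A, insert e A ∈ S.lattice from
    h _ S.univ_mem fun h => hne (Finset.univ_subset_iff.1 h)
  intro C
  induction C using Finset.strongInduction with
  | H C ih =>
    intro hC hCA
    obtain ⟨e, he, heC⟩ := S.accessible C hC
      (Finset.nonempty_iff_ne_empty.2 fun h => hCA (h ▸ Finset.empty_subset A))
    by_cases hsub : C.erase e ⊆ A
    · refine ⟨e, fun heA => hCA ?_, ?_⟩
      · rw [← Finset.insert_erase he]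
        exact Finset.insert_subset heA hsub
      · have : insert e A = C ∪ A := by
          rw [← Finset.insert_erase he, Finset.insert_union, Finset.union_eq_right.2 hsub]
        rw [this]
        exact union_mem hC hA
    · exact ih _ (Finset.erase_ssubset he) heC hsub

theorem IsGreedyVector.exists_extension {A : Finset E} (hA : A ∈ S.lattice) {x : E → ℝ}
    (hx : S.IsGreedyVector A x) :
    ∃ y, S.IsGreedyVector Finset.univ y ∧ ∀ e ∈ A, y e = x e := by
  induction hn : Aᶜ.card generalizing A x with
  | zero =>
    obtain rfl : A = Finset.univ := by simpa using hn
    exact ⟨x, hx, fun _ _ => rfl⟩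
  | succ n ih =>
    obtain ⟨e, he, heA⟩ := exists_insert_mem hA (by rintro rfl; simp at hn)
    obtain ⟨y, hy, hyx⟩ := ih heA (hx.insert_update hA he heA) (by
      rw [Finset.compl_insert, Finset.card_erase_of_mem (by simpa using he), hn]; rfl)
    refine ⟨y, hy, fun a ha => ?_⟩
    rw [hyx a (Finset.mem_insert_of_mem ha), Function.update_of_ne (ne_of_mem_of_not_mem ha he)]

/-! ### The base polyhedron as a solution set -/

variable (S) in
/-- The rows of the system of inequalities defining the base polyhedron. -/
def row : Option S.lattice → E → ℝ
  | some A => indicatorVec A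
  | none => -indicatorVec Finset.univ

variable (S) in
/-- The right-hand side of the system of inequalities defining the base polyhedron. -/
noncomputable def rhs : Option S.lattice → ℝ
  | some A => S.rk A
  | none => -S.rk Finset.univ

theorem basePolyhedron_eq_solutionSet : S.basePolyhedron = solutionSet S.row S.rhs := by
  ext x
  rw [mem_basePolyhedron]
  constructor
  · rintro ⟨h, hE⟩ (_ | A)
    · simp [row, rhs, neg_dotProduct, hE]
    · simpa [row, rhs] using h A A.2
  · intro h
    have h1 : ∀ A ∈ S.lattice, ∑ e ∈ A, x e ≤ S.rk A := fun A hA => by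
      simpa [row, rhs] using h (some ⟨A, hA⟩)
    refine ⟨h1, le_antisymm (h1 _ S.univ_mem) ?_⟩
    simpa [row, rhs, neg_dotProduct] using h none

theorem IsGreedyVector.mem_basePolyhedron {x : E → ℝ} (hx : S.IsGreedyVector Finset.univ x) :
    x ∈ S.basePolyhedron :=
  SubmodularSystem.mem_basePolyhedron.2 ⟨fun A hA => hx.le A hA (Finset.subset_univ A), hx.eq⟩

theorem IsGreedyVector.mem_exposedPoints {x : E → ℝ} (hx : S.IsGreedyVector Finset.univ x) :
    x ∈ Set.exposedPoints ℝ S.basePolyhedron := by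
  have := Fintype.ofFinite S.lattice
  have hmem := hx.mem_basePolyhedron
  rw [basePolyhedron_eq_solutionSet] at hmem ⊢
  refine IsBasicSolution.mem_exposedPoints ⟨hmem, fun v hv => funext fun e => ?_⟩
  refine hx.unique v (fun B hB _ hBx => ?_) e (Finset.mem_univ e)
  simpa [row] using hv (some ⟨B, hB⟩) (by simpa [row, rhs] using hBx)

theorem exists_exposedPoint_sum_eq {A : Finset E} (hA : A ∈ S.lattice) :
    ∃ x ∈ Set.exposedPoints ℝ S.basePolyhedron, ∑ e ∈ A, x e = S.rk A := by
  obtain ⟨x, hx⟩ := exists_isGreedyVector A hA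
  obtain ⟨y, hy, hyx⟩ := hx.exists_extension hA
  exact ⟨y, hy.mem_exposedPoints, (Finset.sum_congr rfl hyx).trans hx.eq⟩

theorem exists_exposedPoint_apply_eq {A : Finset E} (hA : A ∈ S.lattice) {e : E} (he : e ∉ A)
    (heA : insert e A ∈ S.lattice) :
    ∃ x ∈ Set.exposedPoints ℝ S.basePolyhedron, x e = S.rk (insert e A) - S.rk A := by
  obtain ⟨x, hx⟩ := exists_isGreedyVector A hA
  obtain ⟨y, hy, hyx⟩ := (hx.insert_update hA he heA).exists_extension heA
  refine ⟨y, hy.mem_exposedPoints, ?_⟩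
  rw [hyx e (Finset.mem_insert_self e A), Function.update_self]

/-! ### Injectivity -/

theorem add_smul_mem_basePolyhedron {x : E → ℝ} (hx : x ∈ S.basePolyhedron) {i j : E}
    (hij : ∀ B ∈ S.lattice, j ∈ B → i ∈ B) {s : ℝ} (hs : 0 ≤ s) :
    x + s • (Pi.single j 1 - Pi.single i 1 : E → ℝ) ∈ S.basePolyhedron := by
  rw [mem_basePolyhedron] at hx ⊢
  refine ⟨fun B hB => ?_, by rw [sum_add_smul_single_sub_single, hx.2]; simp⟩
  rw [sum_add_smul_single_sub_single]
  have h1 : ((if j ∈ B then 1 else 0) - if i ∈ B then 1 else 0 : ℝ) ≤ 0 := by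
    have := hij B hB
    split_ifs <;> simp_all
  linarith [hx.1 B hB, mul_nonpos_of_nonneg_of_nonpos hs h1]

/-- Otherwise some `j ∈ A` has an `i ∉ A` in its hull, and the ray e_j - e_i stays in the polyhedron
while x(A) grows without bound. -/
theorem mem_lattice_of_sum_le {A : Finset E} {K : ℝ}
    (hK : ∀ x ∈ S.basePolyhedron, ∑ e ∈ A, x e ≤ K) : A ∈ S.lattice := by
  refine mem_of_latticeHull_subset (T := (S.lattice : Set (Finset E))) S.empty_mem S.univ_mem S.lattice.supClosed
    S.lattice.infClosed fun j hj i hi => ?_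
  by_contra hiA
  obtain ⟨x, hx, -⟩ := exists_exposedPoint_sum_eq S.empty_mem
  have hx := hx.1
  have h1 := hK x hx
  have h2 := hK _ (add_smul_mem_basePolyhedron hx (mem_latticeHull.1 hi)
    (s := K - ∑ e ∈ A, x e + 1) (by linarith))
  rw [sum_add_smul_single_sub_single, if_pos hj, if_neg hiA] at h2
  linarith

theorem isGreatest_rk {A : Finset E} (hA : A ∈ S.lattice) :
    IsGreatest ((fun x : E → ℝ => ∑ e ∈ A, x e) '' S.basePolyhedron) (S.rk A) := by
  obtain ⟨x, hx, hxA⟩ := exists_exposedPoint_sum_eq hA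
  refine ⟨⟨x, hx.1, hxA⟩, ?_⟩
  rintro _ ⟨y, hy, rfl⟩
  exact (mem_basePolyhedron.1 hy).1 A hA

theorem basePolyhedron_injective :
    Function.Injective (basePolyhedron : SubmodularSystem E → Set (E → ℝ)) := by
  intro S S' h
  have hsub : ∀ S S' : SubmodularSystem E, S.basePolyhedron = S'.basePolyhedron →
      ∀ A ∈ S.lattice, A ∈ S'.lattice := fun S S' h A hA =>
    mem_lattice_of_sum_le fun x hx => (mem_basePolyhedron.1 (h.symm ▸ hx)).1 A hA
  have hL : S.lattice = S'.lattice :=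
    SetLike.ext fun A => ⟨hsub S S' h A, hsub S' S h.symm A⟩
  have hr : ∀ A (hA : A ∈ S.lattice) (hA' : A ∈ S'.lattice),
      S.rank ⟨A, hA⟩ = S'.rank ⟨A, hA'⟩ := by
    intro A hA hA'
    rw [← rk_of_mem hA, ← rk_of_mem hA']
    exact (isGreatest_rk hA).unique (h ▸ isGreatest_rk hA')
  obtain ⟨L, _, _, _, r, _, _, _⟩ := S
  obtain ⟨L', _, _, _, r', _, _, _⟩ := S'
  obtain rfl : L = L' := hL
  obtain rfl : r = r' := funext fun A => hr A A.2 A.2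
  rfl

/-! ### Tight sets, vertices and edges -/

variable (S) in
/-- The members `A` of the lattice with `x(A) = ρ(A)`. -/
def tightSets (x : E → ℝ) : Set (Finset E) := {A | A ∈ S.lattice ∧ ∑ e ∈ A, x e = S.rk A}

/-- Uncrossing: x is modular and the rank submodular, so the inequalities for union and intersection
must both be equalities. -/
theorem tight_union_inter {x : E → ℝ} (hx : x ∈ S.basePolyhedron) {A B : Finset E}
    (hA : A ∈ S.tightSets x) (hB : B ∈ S.tightSets x) :
    A ∪ B ∈ S.tightSets x ∧ A ∩ B ∈ S.tightSets x := by
  have h1 := union_mem hA.1 hB.1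
  have h2 := inter_mem hA.1 hB.1
  have h3 := (mem_basePolyhedron.1 hx).1 _ h1
  have h4 := (mem_basePolyhedron.1 hx).1 _ h2
  have h5 := rk_submodular hA.1 hB.1
  have h6 := Finset.sum_union_inter (s₁ := A) (s₂ := B) (f := x)
  have h7 := hA.2
  have h8 := hB.2
  exact ⟨⟨h1, by linarith⟩, h2, by linarith⟩

theorem exists_erase_mem_tightSets {x : E → ℝ} (hx : x ∈ S.basePolyhedron)
    (hsep : SeparatesElements (S.tightSets x)) (i : E) :
    ∃ A ∈ S.tightSets x, i ∈ A ∧ A.erase i ∈ S.tightSets x :=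
  hsep.exists_erase_mem ⟨S.empty_mem, by simp [rk_empty]⟩
    ⟨S.univ_mem, (mem_basePolyhedron.1 hx).2⟩ (fun _ hA _ hB => (tight_union_inter hx hA hB).1)
    (fun _ hA _ hB => (tight_union_inter hx hA hB).2) i

/-- If the tight sets do not separate `i` from `j`, the base polyhedron contains a segment
starting at `x` in the direction `e_i - e_j`. -/
theorem exists_add_smul_mem {x : E → ℝ} (hx : x ∈ S.basePolyhedron) {i j : E}
    (hij : ∀ A ∈ S.tightSets x, i ∈ A ↔ j ∈ A) :
    ∃ s : ℝ, 0 < s ∧ x + s • (Pi.single i 1 - Pi.single j 1 : E → ℝ) ∈ S.basePolyhedron := by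
  have := Fintype.ofFinite S.lattice
  obtain ⟨hxle, hxE⟩ := mem_basePolyhedron.1 hx
  obtain ⟨s, hs, hsa⟩ := exists_pos_step
    (fun A : S.lattice => S.rk A - ∑ e ∈ (A : Finset E), x e)
    (fun A : S.lattice => ((if i ∈ (A : Finset E) then 1 else 0) -
      if j ∈ (A : Finset E) then 1 else 0 : ℝ))
    (fun A => sub_nonneg.2 (hxle A A.2)) fun A hA => by
      simp only [hij A ⟨A.2, (sub_eq_zero.1 hA).symm⟩, sub_self, le_refl]
  refine ⟨s, hs, mem_basePolyhedron.2 ⟨fun A hA => ?_, ?_⟩⟩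
  · rw [sum_add_smul_single_sub_single]
    linarith [hsa ⟨A, hA⟩]
  · rw [sum_add_smul_single_sub_single, hxE]
    simp

/-- Both e_i - e_j and its negative are feasible directions at `x`, so a functional maximal at `x`
is constant along them. -/
theorem exists_add_smul_mem_of_isMax {x : E → ℝ} (hx : x ∈ S.basePolyhedron) {i j : E}
    (hij : ∀ A ∈ S.tightSets x, i ∈ A ↔ j ∈ A) (l : (E → ℝ) →L[ℝ] ℝ)
    (hl : ∀ y ∈ S.basePolyhedron, l y ≤ l x) :
    ∃ s : ℝ, 0 < s ∧ x + s • (Pi.single i 1 - Pi.single j 1 : E → ℝ) ∈ S.basePolyhedron ∧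
      l (x + s • (Pi.single i 1 - Pi.single j 1 : E → ℝ)) = l x := by
  obtain ⟨s, hs, hsx⟩ := exists_add_smul_mem hx hij
  obtain ⟨t, ht, htx⟩ := exists_add_smul_mem hx fun A hA => (hij A hA).symm
  refine ⟨s, hs, hsx, ?_⟩
  have h1 := hl _ hsx
  have h2 := hl _ htx
  simp only [map_add, map_smul, map_sub, smul_eq_mul] at h1 h2 ⊢
  set a := l (Pi.single i 1)
  set c := l (Pi.single j 1)
  have h3 : a - c ≤ 0 := nonpos_of_mul_nonpos_right (by linarith) hs
  have h4 : c - a ≤ 0 := nonpos_of_mul_nonpos_right (by linarith) ht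
  rw [show a - c = 0 by linarith, mul_zero, add_zero]

theorem separatesElements_tightSets {x : E → ℝ} (hx : x ∈ Set.exposedPoints ℝ S.basePolyhedron) :
    SeparatesElements (S.tightSets x) := by
  obtain ⟨hx, l, hl⟩ := hx
  intro i j hij
  obtain ⟨s, hs, hsx, hls⟩ := exists_add_smul_mem_of_isMax hx hij l fun y hy => (hl y hy).1
  have h1 := congrFun ((hl _ hsx).2 hls.ge) i
  by_contra hne
  simp [hne, hs.ne'] at h1

theorem isPolyhedron_basePolyhedron : IsPolyhedron S.basePolyhedron := by
  rw [basePolyhedron_eq_solutionSet]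
  exact isPolyhedron_solutionSet _ _

theorem isExtendedGeneralizedPermutahedron_basePolyhedron :
    IsExtendedGeneralizedPermutahedron S.basePolyhedron := by
  refine ⟨isPolyhedron_basePolyhedron, fun F hF hdim => ?_⟩
  have hnt : F.Nontrivial := by
    rw [← Set.not_subsingleton_iff]
    intro hF
    rw [vectorSpan_of_subsingleton ℝ hF, finrank_bot] at hdim
    exact zero_ne_one hdim
  obtain ⟨p, hp, q, hq, hpq⟩ := hnt
  obtain ⟨l, rfl⟩ := hF ⟨p, hp⟩
  obtain ⟨hp, hpl⟩ := hp
  obtain ⟨hq, hql⟩ := hq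
  obtain ⟨hp1, hp2⟩ := mem_basePolyhedron.1 hp
  obtain ⟨hq1, hq2⟩ := mem_basePolyhedron.1 hq
  have hsum : ∀ A : Finset E, ∑ e ∈ A, ((1 / 2 : ℝ) • (p + q)) e
      = (∑ e ∈ A, p e + ∑ e ∈ A, q e) / 2 := fun A => by
    simp only [Pi.smul_apply, Pi.add_apply, smul_eq_mul, ← Finset.mul_sum, Finset.sum_add_distrib]
    ring
  set x : E → ℝ := (1 / 2 : ℝ) • (p + q) with hx_def
  have hx : x ∈ S.basePolyhedron := by
    refine mem_basePolyhedron.2 ⟨fun A hA => ?_, ?_⟩ <;> rw [hsum]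
    · linarith [hp1 A hA, hq1 A hA]
    · rw [hp2, hq2]; ring
  have hxl : ∀ y ∈ S.basePolyhedron, l y ≤ l x := fun y hy => by
    rw [hx_def, map_smul, map_add, smul_eq_mul]
    linarith [hpl y hy, hql y hy]
  have hnsep : ¬SeparatesElements (S.tightSets x) := by
    intro hsep
    -- A set tight at the midpoint is tight at `p` and at `q`; separation makes each coordinate a
    -- difference of two tight sums, forcing `p = q`.
    refine hpq (funext fun i => ?_)
    obtain ⟨A, hA, hiA, hA'⟩ := exists_erase_mem_tightSets hx hsep i
    have key : ∀ B ∈ S.tightSets x, ∑ e ∈ B, p e = ∑ e ∈ B, q e := by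
      intro B hB
      have h1 := hB.2
      rw [hsum] at h1
      linarith [hp1 B hB.1, hq1 B hB.1]
    have h1 := key A hA
    rw [← Finset.add_sum_erase A p hiA, ← Finset.add_sum_erase A q hiA, key _ hA'] at h1
    exact add_right_cancel h1
  simp only [SeparatesElements, not_forall] at hnsep
  obtain ⟨i, j, hij, hne⟩ := hnsep
  obtain ⟨s, hs, hsx, hls⟩ := exists_add_smul_mem_of_isMax hx hij l hxl
  refine ⟨i, j, hne, (Submodule.eq_of_le_of_finrank_eq ?_ ?_).symm⟩
  · rw [Submodule.span_singleton_le_iff_mem]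
    have h1 := vsub_mem_vectorSpan ℝ
      (s := {y ∈ S.basePolyhedron | ∀ z ∈ S.basePolyhedron, l z ≤ l y})
      ⟨hsx, fun y hy => hls ▸ hxl y hy⟩ ⟨hx, hxl⟩
    rw [vsub_eq_sub, add_sub_cancel_left] at h1
    exact (Submodule.smul_mem_iff _ hs.ne').1 h1
  · rw [hdim, finrank_span_singleton]
    intro h
    have := congrFun h i
    simp [hne] at this

/-- A coordinate of a vertex is the difference of the ranks of two tight sets differing by one
element, hence an integer between 0 and 1. -/
theorem IsUMatroid.isUPolyhedron (hS : S.IsUMatroid) : IsUPolyhedron S.basePolyhedron := by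
  refine ⟨isExtendedGeneralizedPermutahedron_basePolyhedron, fun v hv i => ?_, ?_⟩
  · obtain ⟨A, hA, hiA, hA'⟩ := exists_erase_mem_tightSets hv.1 (separatesElements_tightSets hv) i
    have h1 := Finset.add_sum_erase A v hiA
    rw [hA.2, hA'.2] at h1
    have h2 := rk_mono hA'.1 hA.1 (Finset.erase_subset i A)
    have h3 := hS.2 ⟨_, hA'.1⟩ ⟨_, hA.1⟩ i (Finset.insert_erase hiA).symm
    obtain ⟨k, hk⟩ := hS.1 ⟨_, hA'.1⟩
    obtain ⟨n, hn⟩ := hS.1 ⟨_, hA.1⟩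
    rw [← rk_of_mem] at hk hn h3
    rw [← rk_of_mem hA'.1] at h3
    rw [hk, hn] at h1 h2 h3
    have h4 : k ≤ n := by exact_mod_cast h2
    have h5 : n ≤ k + 1 := by
      have : (n : ℝ) ≤ k + 1 := by linarith
      exact_mod_cast this
    obtain rfl | rfl : n = k ∨ n = k + 1 := by omega
    · left; linarith
    · right; push_cast at h1; linarith
  · obtain ⟨x, hx, -⟩ := exists_exposedPoint_sum_eq S.empty_mem
    exact ⟨x, hx⟩

/-- The rank of a set is a sum of coordinates of a greedy vertex, and a rank increment is a single
coordinate of one. -/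
theorem isUMatroid_of_isUPolyhedron (h : IsUPolyhedron S.basePolyhedron) : S.IsUMatroid := by
  obtain ⟨-, h01, -⟩ := h
  refine ⟨fun A => ?_, fun A B e hB => ?_⟩
  · obtain ⟨x, hx, hxA⟩ := exists_exposedPoint_sum_eq A.2
    refine ⟨(A.1.filter fun e => x e = 1).card, ?_⟩
    rw [← rk_of_mem A.2, ← hxA, Finset.card_filter, Nat.cast_sum]
    refine Finset.sum_congr rfl fun e _ => ?_
    rcases h01 x hx e with h | h <;> simp [h]
  · by_cases he : e ∈ (A : Finset E)
    · rw [Finset.insert_eq_of_mem he] at hB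
      rw [Subtype.ext hB]
      simp
    · have heA : insert e (A : Finset E) ∈ S.lattice := hB ▸ B.2
      obtain ⟨x, hx, hxe⟩ := exists_exposedPoint_apply_eq A.2 he heA
      have hB' : B = ⟨_, heA⟩ := Subtype.ext hB
      rw [hB', ← rk_of_mem heA, ← rk_of_mem A.2, ← hxe]
      rcases h01 x hx e with h | h <;> simp [h]

end SubmodularSystem

/-! ### From a 0/1 permutahedron back to a submodular system -/

/-- Abel summation: if `z` has nonpositive sum on each upper level set of `w`, then so has
`(w - c) z` for every lower bound `c` of `w`. -/
theorem sum_sub_mul_nonpos_of_upperSets {E : Type*} (w z : E → ℝ) (s : Finset E)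
    (h : ∀ U ⊆ s, (∀ a ∈ U, ∀ b ∈ s, w a ≤ w b → b ∈ U) → ∑ e ∈ U, z e ≤ 0) (c : ℝ)
    (hc : ∀ e ∈ s, c ≤ w e) : ∑ e ∈ s, (w e - c) * z e ≤ 0 := by
  classical
  induction s using Finset.strongInduction generalizing c with
  | H s ih =>
    rcases s.eq_empty_or_nonempty with rfl | hne
    · simp
    obtain ⟨a, ha, hmin⟩ := Finset.exists_min_image s w hne
    have hsub : s.filter (fun e => w a < w e) ⊆ s := Finset.filter_subset _ _
    -- Discard the lowest level of `w` and induct with its value as the new lower bound; the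
    -- discarded terms vanish.
    have h1 : ∑ e ∈ s.filter (fun e => w a < w e), (w e - w a) * z e ≤ 0 := by
      refine ih _ (Finset.filter_ssubset.2 ⟨a, ha, lt_irrefl (w a)⟩) (fun U hU hup => ?_) _
        fun e he => le_of_lt (Finset.mem_filter.1 he).2
      refine h U (hU.trans hsub) fun i hi j hj hij => hup i hi j ?_ hij
      exact Finset.mem_filter.2 ⟨hj, (Finset.mem_filter.1 (hU hi)).2.trans_le hij⟩
    have h2 : ∑ e ∈ s.filter (fun e => w a < w e), (w e - w a) * z e
        = ∑ e ∈ s, (w e - w a) * z e := by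
      refine Finset.sum_filter_of_ne fun e he hne => lt_of_le_of_ne (hmin e he) fun heq => hne ?_
      rw [heq, sub_self, zero_mul]
    have h3 : ∑ e ∈ s, (w e - c) * z e
        = ∑ e ∈ s, (w e - w a) * z e + (w a - c) * ∑ e ∈ s, z e := by
      rw [Finset.mul_sum, ← Finset.sum_add_distrib]
      exact Finset.sum_congr rfl fun e _ => by ring
    have h4 := h s subset_rfl fun _ _ b hb _ => hb
    rw [h3, ← h2]
    linarith [mul_nonpos_of_nonneg_of_nonpos (sub_nonneg.2 (hc a ha)) h4]

section Permutahedra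

variable {E : Type*} [Fintype E] [DecidableEq E]

/-- In an extended 0/1 generalized permutahedron, a functional `w` which is bounded above is
maximised at a vertex which also maximises every functional whose coefficients are ordered
compatibly with those of `w`. -/
theorem IsUPolyhedron.exists_common_max {p : Set (E → ℝ)} (hp : IsUPolyhedron p) {w : E → ℝ}
    {K : ℝ} (hK : ∀ y ∈ p, w ⬝ᵥ y ≤ K) :
    ∃ x ∈ p, (∀ e, x e = 0 ∨ x e = 1) ∧
      ∀ u : E → ℝ, (∀ i j, w i ≤ w j → u i ≤ u j) → ∀ y ∈ p, u ⬝ᵥ y ≤ u ⬝ᵥ x := by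
  obtain ⟨⟨⟨m, M, b, hM⟩, hedge⟩, h01, x₀, hx₀⟩ := hp
  replace hM : p = solutionSet M b := hM
  subst hM
  have hlin := eq_zero_of_mem_exposedPoints hx₀
  -- Basic solutions are vertices, hence 0/1 vectors, so there are finitely many and one is best for
  -- `w`.
  have hfin : {x | IsBasicSolution M b x}.Finite :=
    (Set.Finite.pi' fun _ : E => Set.toFinite {(0 : ℝ), 1}).subset fun x hx e =>
      h01 x hx.mem_exposedPoints e
  obtain ⟨x₁, hx₁, -⟩ := exists_isBasicSolution_ge hlin hK hx₀.1
  obtain ⟨x, hx, hmax⟩ := Set.exists_max_image _ (fun x => w ⬝ᵥ x) hfin ⟨x₁, hx₁⟩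
  have hmax' : ∀ y ∈ solutionSet M b, w ⬝ᵥ y ≤ w ⬝ᵥ x := fun y hy => by
    obtain ⟨z, hz, hyz⟩ := exists_isBasicSolution_ge hlin hK hy
    exact hyz.trans (hmax z hz)
  refine ⟨x, hx.1, h01 x hx.mem_exposedPoints, fun u hu y hy => ?_⟩
  by_contra! hlt
  -- An edge improving `u` has direction c(e_i - e_j). Since it does not improve `w`, it fixes the
  -- order of `w i` and `w j`, and compatibility then prevents it from improving `u`.
  obtain ⟨d, F, hud, hxd, hF, hspan⟩ := hx.exists_edge hy hlt
  have hd0 : d ≠ 0 := by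
    rintro rfl
    simp at hud
  obtain ⟨i, j, -, hij⟩ := hedge F hF (by rw [hspan, finrank_span_singleton hd0])
  have hd : d ∈ Submodule.span ℝ {(Pi.single i 1 - Pi.single j 1 : E → ℝ)} := by
    rw [← hij, hspan]
    exact Submodule.mem_span_singleton_self d
  obtain ⟨c, rfl⟩ := Submodule.mem_span_singleton.1 hd
  have hwd := hmax' _ hxd
  rw [dotProduct_add] at hwd
  simp only [dotProduct_smul, dotProduct_sub, dotProduct_single, mul_one, smul_eq_mul] at hud hwd
  rcases lt_trichotomy c 0 with hc | rfl | hc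
  · have h1 : 0 ≤ w i - w j := by
      by_contra! h
      linarith [mul_pos_of_neg_of_neg hc h]
    have h2 := hu j i (by linarith)
    linarith [mul_nonpos_of_nonpos_of_nonneg hc.le (sub_nonneg.2 h2)]
  · simp at hud
  · have h1 : w i - w j ≤ 0 := by
      by_contra! h
      linarith [mul_pos hc h]
    have h2 := hu i j (by linarith)
    linarith [mul_nonpos_of_nonneg_of_nonpos hc.le (sub_nonpos.2 h2)]

/-- The sets `A` for which `x(A)` is bounded above on `p`. -/
def boundedSets (p : Set (E → ℝ)) : Set (Finset E) := {A | ∃ K, ∀ y ∈ p, ∑ e ∈ A, y e ≤ K}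

theorem IsUPolyhedron.exists_common_max_upperSet {p : Set (E → ℝ)} (hp : IsUPolyhedron p)
    {w : E → ℝ} {K : ℝ} (hK : ∀ y ∈ p, w ⬝ᵥ y ≤ K) :
    ∃ x ∈ p, (∀ e, x e = 0 ∨ x e = 1) ∧ (∀ y ∈ p, w ⬝ᵥ y ≤ w ⬝ᵥ x) ∧
      ∀ U : Finset E, (∀ i ∈ U, ∀ j, w i ≤ w j → j ∈ U) →
        ∀ y ∈ p, ∑ e ∈ U, y e ≤ ∑ e ∈ U, x e := by
  obtain ⟨x, hx, h01, hmax⟩ := hp.exists_common_max hK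
  refine ⟨x, hx, h01, hmax w fun _ _ h => h, fun U hU y hy => ?_⟩
  have := hmax (indicatorVec U) (fun i j hij => ?_) y hy
  · simpa using this
  · have := fun h => hU i h j hij
    unfold indicatorVec
    split_ifs <;> first | (norm_num; done) | tauto

/-- The constants 1 and -1 are both ordered compatibly with w = 0, so one point maximises and
minimises the coordinate sum. -/
theorem IsUPolyhedron.sum_eq {p : Set (E → ℝ)} (hp : IsUPolyhedron p) {x y : E → ℝ} (hx : x ∈ p)
    (hy : y ∈ p) : ∑ e, x e = ∑ e, y e := by
  obtain ⟨z, -, -, hz⟩ := hp.exists_common_max (w := 0) (K := 0) (by simp)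
  have h : ∀ x ∈ p, ∑ e, x e = ∑ e, z e := fun x hx => by
    have h1 := hz 1 (by simp) x hx
    have h2 := hz (-1) (by simp) x hx
    simp only [neg_dotProduct, one_dotProduct] at h1 h2
    linarith
  rw [h x hx, h y hy]

theorem IsUPolyhedron.exists_isGreatest {p : Set (E → ℝ)} (hp : IsUPolyhedron p) {A : Finset E}
    (hA : A ∈ boundedSets p) :
    ∃ x ∈ p, (∀ e, x e = 0 ∨ x e = 1) ∧ ∀ y ∈ p, ∑ e ∈ A, y e ≤ ∑ e ∈ A, x e := by
  obtain ⟨K, hK⟩ := hA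
  obtain ⟨x, hx, h01, hmax, -⟩ := hp.exists_common_max_upperSet (w := indicatorVec A) (K := K)
    (by simpa using hK)
  exact ⟨x, hx, h01, by simpa using hmax⟩

/-- Any two members of `boundedSets p` have a common maximiser for their sums and the sums over
their union and intersection. -/
theorem IsUPolyhedron.exists_isGreatest_union_inter {p : Set (E → ℝ)} (hp : IsUPolyhedron p)
    {A B : Finset E} (hA : A ∈ boundedSets p) (hB : B ∈ boundedSets p) :
    ∃ x ∈ p, (∀ y ∈ p, ∑ e ∈ A ∪ B, y e ≤ ∑ e ∈ A ∪ B, x e) ∧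
      ∀ y ∈ p, ∑ e ∈ A ∩ B, y e ≤ ∑ e ∈ A ∩ B, x e := by
  obtain ⟨K, hK⟩ := hA
  obtain ⟨L, hL⟩ := hB
  -- The union and the intersection are the level sets w ≥ 1 and w ≥ 2 of the sum of the two
  -- indicators.
  obtain ⟨x, hx, -, -, hU⟩ := hp.exists_common_max_upperSet
    (w := indicatorVec A + indicatorVec B) (K := K + L) fun y hy => by
      rw [add_dotProduct, indicatorVec_dotProduct, indicatorVec_dotProduct]
      exact add_le_add (hK y hy) (hL y hy)
  refine ⟨x, hx, hU _ fun i hi j hij => ?_, hU _ fun i hi j hij => ?_⟩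
  · by_contra hj
    rw [Finset.mem_union] at hi hj
    simp only [Pi.add_apply, indicatorVec] at hij
    split_ifs at hij <;> first | (norm_num at hij; done) | tauto
  · by_contra hj
    rw [Finset.mem_inter] at hi hj
    simp only [Pi.add_apply, indicatorVec] at hij
    split_ifs at hij <;> first | (norm_num at hij; done) | tauto

/-- Upper level sets of a row are bounded sets, so inseparable `i` and `j` have equal entries in
every row. If distinct, they would give a line direction e_i - e_j, which a vertex excludes. -/
theorem IsUPolyhedron.separatesElements_boundedSets {p : Set (E → ℝ)} (hp : IsUPolyhedron p) :
    SeparatesElements (boundedSets p) := by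
  intro i j hij
  have hp' := hp
  obtain ⟨⟨⟨m, M, b, hM⟩, -⟩, -, x₀, hx₀⟩ := hp'
  replace hM : p = solutionSet M b := hM
  subst hM
  have key : ∀ k i j, (∀ A ∈ boundedSets (solutionSet M b), j ∈ A → i ∈ A) → M k j ≤ M k i := by
    intro k i j hij
    obtain ⟨x, -, -, -, hU⟩ := hp.exists_common_max_upperSet (w := M k) fun y hy => hy k
    have hmem : (Finset.univ.filter fun e => M k j ≤ M k e) ∈ boundedSets (solutionSet M b) :=
      ⟨_, hU _ fun a ha c hac => by
        simp only [Finset.mem_filter, Finset.mem_univ, true_and] at ha ⊢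
        exact ha.trans hac⟩
    simpa using hij _ hmem (by simp)
  have h := eq_zero_of_mem_exposedPoints hx₀ (Pi.single i 1 - Pi.single j 1) fun k => by
    rw [dotProduct_sub, dotProduct_single, dotProduct_single, mul_one, mul_one, sub_eq_zero]
    exact le_antisymm (key k j i fun A hA => (hij A hA).1) (key k i j fun A hA => (hij A hA).2)
  by_contra hne
  have := congrFun h i
  simp [hne] at this

/-- Every extended 0/1 generalized permutahedron is the base polyhedron of a submodular system. -/
theorem IsUPolyhedron.exists_basePolyhedron_eq {p : Set (E → ℝ)} (hp : IsUPolyhedron p) :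
    ∃ S : SubmodularSystem E, S.basePolyhedron = p := by
  have hr : ∀ A, ∃ r : ℝ, A ∈ boundedSets p →
      IsGreatest ((fun y : E → ℝ => ∑ e ∈ A, y e) '' p) r := fun A => by
    by_cases hA : A ∈ boundedSets p
    · obtain ⟨x, hx, -, hmax⟩ := hp.exists_isGreatest hA
      exact ⟨_, fun _ => ⟨⟨x, hx, rfl⟩, by rintro _ ⟨y, hy, rfl⟩; exact hmax y hy⟩⟩
    · exact ⟨0, fun h => absurd h hA⟩
  choose ρ hρ using hr
  have hle : ∀ A ∈ boundedSets p, ∀ y ∈ p, ∑ e ∈ A, y e ≤ ρ A := fun A hA y hy =>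
    (hρ A hA).2 ⟨y, hy, rfl⟩
  have heq : ∀ A (x : E → ℝ), x ∈ p → (∀ y ∈ p, ∑ e ∈ A, y e ≤ ∑ e ∈ A, x e) →
      A ∈ boundedSets p ∧ ρ A = ∑ e ∈ A, x e := fun A x hx h => by
    have hA : A ∈ boundedSets p := ⟨_, h⟩
    refine ⟨hA, (hρ A hA).unique ⟨⟨x, hx, rfl⟩, ?_⟩⟩
    rintro _ ⟨y, hy, rfl⟩
    exact h y hy
  obtain ⟨x₀, hx₀⟩ := hp.2.2
  have hempty := heq ∅ x₀ hx₀.1 (by simp)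
  have huniv := heq Finset.univ x₀ hx₀.1 fun y hy => (hp.sum_eq hy hx₀.1).le
  have hsup : SupClosed (boundedSets p) := fun A hA B hB => by
    obtain ⟨x, hx, h, -⟩ := hp.exists_isGreatest_union_inter hA hB
    exact (heq _ x hx h).1
  have hinf : InfClosed (boundedSets p) := fun A hA B hB => by
    obtain ⟨x, hx, -, h⟩ := hp.exists_isGreatest_union_inter hA hB
    exact (heq _ x hx h).1
  let S : SubmodularSystem E :=
    { lattice := ⟨boundedSets p, hsup, hinf⟩
      empty_mem := hempty.1
      univ_mem := huniv.1
      accessible := fun A hA hne =>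
        hp.separatesElements_boundedSets.accessible hempty.1 huniv.1 hsup hinf hA hne
      rank := fun A => ρ A
      calibrated := by simpa using hempty.2
      -- The maximum on `A` is attained at a 0/1 point, where enlarging the set cannot decrease the
      -- sum.
      monotone := fun A B hAB => by
        obtain ⟨x, hx, h01, h⟩ := hp.exists_isGreatest A.2
        refine (heq _ x hx h).2.le.trans (le_trans ?_ (hle B B.2 x hx))
        refine Finset.sum_le_sum_of_subset_of_nonneg hAB fun e _ _ => ?_
        rcases h01 e with h | h <;> simp [h]
      submodular := fun A B => by
        obtain ⟨x, hx, h1, h2⟩ := hp.exists_isGreatest_union_inter A.2 B.2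
        have h3 : ρ ((A : Finset E) ∪ B) + ρ ((A : Finset E) ∩ B) ≤ ρ A + ρ B := by
          rw [(heq _ x hx h1).2, (heq _ x hx h2).2, Finset.sum_union_inter]
          exact add_le_add (hle A A.2 x hx) (hle B B.2 x hx)
        exact h3 }
  refine ⟨S, Set.Subset.antisymm (fun y hy => ?_) fun y hy =>
    ⟨fun A => hle A A.2 y hy, (hp.sum_eq hy hx₀.1).trans huniv.2.symm⟩⟩
  obtain ⟨hyle, hyE⟩ := hy
  obtain ⟨⟨⟨m, M, b, hM⟩, -⟩, -⟩ := id hp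
  have hpk : ∀ x ∈ p, ∀ k, M k ⬝ᵥ x ≤ b k := fun x hx => by
    rw [hM] at hx
    exact hx
  suffices h : ∀ k, M k ⬝ᵥ y ≤ b k by
    rw [hM]
    exact h
  intro k
  obtain ⟨x, hx, -, -, hU⟩ := hp.exists_common_max_upperSet (w := M k) fun y hy => hpk y hy k
  refine le_trans ?_ (hpk x hx k)
  obtain ⟨c, hc⟩ : ∃ c, ∀ e, c ≤ M k e :=
    (Set.finite_range (M k)).bddBelow.imp fun c hc e => hc ⟨e, rfl⟩
  -- The point `x` attains `ρ U` on every upper level set `U` of the row, so `y - x` has nonpositive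
  -- sum there. As its total sum is zero, the shift by `c` is harmless.
  have habel := sum_sub_mul_nonpos_of_upperSets (M k) (y - x) Finset.univ
    (fun U _ hup => ?_) c fun e _ => hc e
  · have h0 : ∑ e, (y - x) e = 0 := by
      simp only [Pi.sub_apply, Finset.sum_sub_distrib]
      rw [hyE, hp.sum_eq hx hx₀.1, sub_eq_zero]
      exact huniv.2
    have h1 : M k ⬝ᵥ (y - x) = ∑ e, (M k e - c) * (y - x) e := by
      simp only [sub_mul, Finset.sum_sub_distrib, ← Finset.mul_sum, h0, mul_zero, sub_zero]
      rfl
    rw [dotProduct_sub] at h1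
    linarith
  · obtain ⟨hUm, hUρ⟩ := heq U x hx (hU U fun i hi j => hup i hi j (Finset.mem_univ j))
    simp only [Pi.sub_apply, Finset.sum_sub_distrib, sub_nonpos, ← hUρ]
    exact hyle ⟨U, hUm⟩

end Permutahedra

theorem theorem3p3 (E : Type*) [Fintype E] [DecidableEq E] :
    Function.Injective
      (SubmodularSystem.basePolyhedron : SubmodularSystem E → Set (E → ℝ)) ∧
    Set.BijOn (SubmodularSystem.basePolyhedron : SubmodularSystem E → Set (E → ℝ))
      {S | S.IsUMatroid} {p | IsUPolyhedron p} ∧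
    ∀ S : SubmodularSystem E, S.IsUMatroid ↔ IsUPolyhedron S.basePolyhedron := by
  refine ⟨SubmodularSystem.basePolyhedron_injective, ⟨fun S hS => hS.isUPolyhedron,
    SubmodularSystem.basePolyhedron_injective.injOn, fun p hp => ?_⟩, fun S =>
    ⟨fun hS => hS.isUPolyhedron, SubmodularSystem.isUMatroid_of_isUPolyhedron⟩⟩
  obtain ⟨S, rfl⟩ := IsUPolyhedron.exists_basePolyhedron_eq hp
  exact ⟨S, SubmodularSystem.isUMatroid_of_isUPolyhedron hp, rfl⟩
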